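/- Let $G$ be a finite group. Write $\Phi(G)$ for its Frattini subgroup, $m(G)$ for the number of maximal subgroups of $G$ and, when $G$ is not cyclic, $\sigma(G)$ for the least positive integer $n$ such that $G$ is the union of $n$ proper subgroups. If $G$ is soluble and non-nilpotent and $\sigma(G)=m(G)$, then $\sigma(G)\neq 3$, and there exist an elementary abelian group $E$ of order $\sigma(G)-1$, a prime $p$, an integer $\alpha>0$ and a faithful action of the cyclic group $\mathbb{Z}_{p^{\alpha}}$ on $E$ by automorphisms such that $G/\Phi(G)\cong E\rtimes\mathbb{Z}_{p^{\alpha}}$, the semidirect product being formed with this action. -/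

import Mathlib

universe u

/-- `G` is the union of `n` proper subgroups. -/
def IsUnionOfProperSubgroups (G : Type u) [Group G] (n : ℕ) : Prop :=
  ∃ H : Fin n → Subgroup G, (∀ i, H i ≠ ⊤) ∧ (⋃ i, (H i : Set G)) = Set.univ

/-- `σ(G)`: the least positive integer `n` such that `G` is the union of `n` proper subgroups.
For a finite group such an `n` exists exactly when `G` is not cyclic; the value is `0` otherwise. -/
noncomputable def coveringNumber (G : Type u) [Group G] : ℕ :=
  sInf {n : ℕ | 0 < n ∧ IsUnionOfProperSubgroups G n}

/-- `m(G)`: the number of maximal subgroups of `G`. -/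
noncomputable def numMaximalSubgroups (G : Type u) [Group G] : ℕ :=
  Nat.card {M : Subgroup G // IsCoatom M}

/-- `E` is an elementary abelian group: abelian, and of exponent dividing some prime. -/
def IsElementaryAbelian (E : Type u) [Group E] : Prop :=
  (∀ x y : E, x * y = y * x) ∧ ∃ r : ℕ, r.Prime ∧ ∀ x : E, x ^ r = 1

/-! If some maximal subgroup had each of its elements in another one, the remaining maximal
subgroups would cover the non-cyclic group `G`, forcing σ(G) < m(G). So each maximal subgroup has a
private element (`hasPrivateElements_of_coveringNumber_eq`). Since `G` is not nilpotent, some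
maximal `X` is not normal. Its private element generates `G` modulo `G'`, and solubility puts `G''`
in `X`; hence `G / core X` is the product of its abelian derived subgroup `V` and a cyclic
complement acting without fixed points. Elements outside `V` are then conjugate into `X`, so private
elements leave only one normal maximal subgroup `M` and the conjugates of `X`
(`exists_isCoatom_iff`). Thus Φ(G) = core X and m(G) = |V| + 1, and uniqueness of `M` makes the
complement a `p`-group. -/

open Subgroup

/-! ### Abelian normal subgroups with a core-free maximal complement -/

section Primitive

variable {Q : Type*} [Group Q] {V X : Subgroup Q}

theorem eq_bot_or_eq_of_normal_le (hX : IsCoatom X) (hd : V ⊓ X = ⊥) {T : Subgroup Q}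
    [T.Normal] (hT : T ≤ V) : T = ⊥ ∨ T = V := by
  by_cases h : T ≤ X
  · exact Or.inl (le_bot_iff.1 (hd ▸ le_inf hT h))
  · right
    have htop : T ⊔ X = ⊤ := hX.2 _ (lt_of_le_of_ne le_sup_right fun he => h (he ▸ le_sup_left))
    refine le_antisymm hT fun v hv => ?_
    obtain ⟨t, ht, x, hx, rfl⟩ := mem_sup_of_normal_left.1 (htop ▸ mem_top v)
    have : x ∈ V ⊓ X := ⟨(V.mul_mem_cancel_left (hT ht)).1 hv, hx⟩
    rw [hd, mem_bot] at this
    simpa [this] using ht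

variable [V.Normal] (hX : IsCoatom X) (hd : V ⊓ X = ⊥)
  (hV : ∀ a ∈ V, ∀ b ∈ V, a * b = b * a) (hXc : ∀ a ∈ X, ∀ b ∈ X, a * b = b * a)
  (hs : V ⊔ X = ⊤) (hc : X.normalCore = ⊥)

include hs hXc hc in
theorem eq_one_of_mem_of_commute {x : Q} (hx : x ∈ X) (h : ∀ v ∈ V, x * v = v * x) : x = 1 := by
  have : x ∈ X.normalCore := by
    intro b
    obtain ⟨v, hv, z, hz, rfl⟩ := mem_sup_of_normal_left.1 (hs ▸ mem_top b)
    have h1 : v * z * x * (v * z)⁻¹ = x := by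
      rw [mul_inv_eq_iff_eq_mul, mul_assoc, hXc z hz x hx, ← mul_assoc, ← mul_assoc, h v hv]
    rwa [h1]
  rwa [hc, mem_bot] at this

include hX hd hV hs hXc hc in
-- The fixed points of `x` in `V` are normal in `VX`, as `V` and `X` are abelian. By minimality of
-- `V` they are trivial or all of `V`, and faithfulness excludes the latter.
theorem eq_one_of_commute {x v : Q} (hx : x ∈ X) (hx1 : x ≠ 1) (hv : v ∈ V)
    (hxv : x * v = v * x) : v = 1 := by
  have hT : (V ⊓ centralizer {x}).Normal := by
    refine ⟨fun n hn b => ⟨‹V.Normal›.conj_mem _ hn.1 _, ?_⟩⟩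
    obtain ⟨w, hw, z, hz, rfl⟩ := mem_sup_of_normal_left.1 (hs ▸ mem_top b)
    have hn2 := mem_centralizer_singleton_iff.1 hn.2
    have h1 : w * z * n * (w * z)⁻¹ = z * n * z⁻¹ := by
      have := hV w hw (z * n * z⁻¹) (‹V.Normal›.conj_mem _ hn.1 _)
      calc w * z * n * (w * z)⁻¹ = w * (z * n * z⁻¹) * w⁻¹ := by group
        _ = z * n * z⁻¹ := by rw [this, mul_inv_cancel_right]
    have hzx : Commute z x := hXc z hz x hx
    have hnx : Commute n x := hn2
    rw [h1]
    exact mem_centralizer_singleton_iff.2 ((hzx.mul_left hnx).mul_left hzx.inv_left)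
  rcases eq_bot_or_eq_of_normal_le hX hd (T := V ⊓ centralizer {x}) inf_le_left with h | h
  · have : v ∈ V ⊓ centralizer {x} := ⟨hv, mem_centralizer_singleton_iff.2 hxv.symm⟩
    rwa [h, mem_bot] at this
  · refine absurd (eq_one_of_mem_of_commute hXc hs hc hx fun u hu => ?_) hx1
    rw [← h] at hu
    exact (mem_centralizer_singleton_iff.1 hu.2).symm

include hX hd hV hs hXc hc in
theorem exists_conj_mem_of_notMem [Finite Q] {y : Q} (hy : y ∉ V) : ∃ t, t * y * t⁻¹ ∈ X := by
  obtain ⟨v, hv, x, hx, rfl⟩ := mem_sup_of_normal_left.1 (hs ▸ mem_top y)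
  have hx1 : x ≠ 1 := by
    rintro rfl
    exact hy (by simpa using hv)
  -- Solving `f t = v` amounts to `t * (v * x) * t⁻¹ = x`; fixed-point freeness makes `f` injective,
  -- hence onto.
  let f : V → V := fun t => ⟨(t : Q)⁻¹ * (x * t * x⁻¹),
    V.mul_mem (V.inv_mem t.2) (‹V.Normal›.conj_mem _ t.2 _)⟩
  have hf : Function.Injective f := by
    intro t s hts
    have h1 : (t : Q)⁻¹ * (x * t * x⁻¹) = (s : Q)⁻¹ * (x * s * x⁻¹) := congrArg Subtype.val hts
    have h2 : (s : Q) * (t : Q)⁻¹ = 1 := by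
      refine eq_one_of_commute hX hd hV hXc hs hc hx hx1 (V.mul_mem s.2 (V.inv_mem t.2)) ?_
      have h3 : (t : Q)⁻¹ * x * t = (s : Q)⁻¹ * x * s := by
        simpa [← mul_assoc] using h1
      calc x * (s * (t : Q)⁻¹) = s * ((s : Q)⁻¹ * x * s) * (t : Q)⁻¹ := by group
        _ = s * (t : Q)⁻¹ * x := by rw [← h3]; group
    exact Subtype.ext (mul_inv_eq_one.1 h2).symm
  obtain ⟨t, ht⟩ := Finite.surjective_of_injective hf ⟨v, hv⟩
  have ht' : (t : Q)⁻¹ * (x * t * x⁻¹) = v := congrArg Subtype.val ht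
  refine ⟨t, ?_⟩
  have : (t : Q) * (v * x) * (t : Q)⁻¹ = x := by rw [← ht']; group
  rwa [this]

end Primitive

/-! ### Private elements and the cyclic complement -/

/-- Every maximal subgroup has an element that lies in no other maximal subgroup. -/
def HasPrivateElements (G : Type*) [Group G] : Prop :=
  ∀ M : Subgroup G, IsCoatom M → ∃ g ∈ M, ∀ M' : Subgroup G, IsCoatom M' → g ∈ M' → M' = M

theorem hasPrivateElements_of_coveringNumber_eq {G : Type*} [Group G] [Finite G]
    (hcyc : ¬ IsCyclic G) (hσ : coveringNumber G = numMaximalSubgroups G) :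
    HasPrivateElements G := by
  intro M hM
  by_contra! hcon
  let C := {K : Subgroup G // IsCoatom K ∧ K ≠ M}
  have hcov : ∀ g : G, ∃ K : C, g ∈ K.1 := by
    intro g
    have hz : zpowers g ≠ ⊤ := fun h => hcyc (isCyclic_iff_exists_zpowers_eq_top.2 ⟨g, h⟩)
    obtain ⟨K, hK, hgK⟩ := (eq_top_or_exists_le_coatom (zpowers g)).resolve_left hz
    have hg : g ∈ K := hgK (mem_zpowers g)
    by_cases hKM : K = M
    · obtain ⟨K', hK', hg', hne⟩ := hcon g (hKM ▸ hg)
      exact ⟨⟨K', hK', hne⟩, hg'⟩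
    · exact ⟨⟨K, hK, hKM⟩, hg⟩
  have hCpos : 0 < Nat.card C := Nat.card_pos_iff.2 ⟨⟨(hcov 1).choose⟩, inferInstance⟩
  have hle : coveringNumber G ≤ Nat.card C := by
    refine Nat.sInf_le ⟨hCpos, fun i => ((Finite.equivFin C).symm i).1,
      fun i => ((Finite.equivFin C).symm i).2.1.1, Set.eq_univ_of_forall fun g => ?_⟩
    obtain ⟨K, hK⟩ := hcov g
    exact Set.mem_iUnion.2 ⟨Finite.equivFin C K, by simpa using hK⟩
  have hlt : Nat.card C < numMaximalSubgroups G := by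
    rw [numMaximalSubgroups]
    exact Set.ncard_lt_ncard (s := {K : Subgroup G | IsCoatom K ∧ K ≠ M})
      (t := {K : Subgroup G | IsCoatom K}) ⟨fun K h => h.1, fun h => (h hM).2 rfl⟩
  omega

/-- `Q` is the semidirect product of an abelian normal subgroup `V` and a nontrivial cyclic
core-free maximal subgroup generated by `g`. -/
structure IsCyclicPrimitive {Q : Type*} [Group Q] (V X : Subgroup Q) (g : Q) : Prop where
  normal : V.Normal
  isCoatom : IsCoatom X
  inf_eq_bot : V ⊓ X = ⊥
  comm : ∀ a ∈ V, ∀ b ∈ V, a * b = b * a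
  sup_eq_top : V ⊔ X = ⊤
  normalCore_eq_bot : X.normalCore = ⊥
  zpowers_eq : X = zpowers g
  not_normal : ¬ X.Normal

theorem IsCyclicPrimitive.comm_right {Q : Type*} [Group Q] {V X : Subgroup Q} {g : Q}
    (h : IsCyclicPrimitive V X g) : ∀ a ∈ X, ∀ b ∈ X, a * b = b * a := by
  rw [h.zpowers_eq]
  rintro _ ⟨i, rfl⟩ _ ⟨j, rfl⟩
  exact zpow_mul_comm g i j

theorem isCyclicPrimitive_commutator {Q : Type*} [Group Q] {X : Subgroup Q} {g : Q}
    (hX : IsCoatom X) (hc : X.normalCore = ⊥) (hn : ¬ X.Normal)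
    (hcomm : ⁅commutator Q, commutator Q⁆ = ⊥) (hg : g ∈ X)
    (htop : commutator Q ⊔ zpowers g = ⊤) : IsCyclicPrimitive (commutator Q) X g := by
  have hV : ∀ a ∈ commutator Q, ∀ b ∈ commutator Q, a * b = b * a := fun a ha b hb =>
    commutatorElement_eq_one_iff_mul_comm.1
      ((mem_bot (G := Q)).1 (hcomm ▸ commutator_mem_commutator ha hb))
  have hs : commutator Q ⊔ X = ⊤ :=
    top_le_iff.1 (htop ▸ sup_le_sup_left (zpowers_le.2 hg) _)
  have hd : commutator Q ⊓ X = ⊥ := by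
    have : (commutator Q ⊓ X).Normal := by
      refine ⟨fun n hn b => ?_⟩
      obtain ⟨w, hw, z, hz, rfl⟩ := mem_sup_of_normal_left.1 (hs ▸ mem_top b)
      have hmem : z * n * z⁻¹ ∈ commutator Q := Normal.conj_mem inferInstance _ hn.1 _
      have h1 : w * z * n * (w * z)⁻¹ = z * n * z⁻¹ := by
        calc w * z * n * (w * z)⁻¹ = w * (z * n * z⁻¹) * w⁻¹ := by group
          _ = z * n * z⁻¹ := by rw [hV w hw _ hmem, mul_inv_cancel_right]
      rw [h1]
      exact ⟨hmem, X.mul_mem (X.mul_mem hz hn.2) (X.inv_mem hz)⟩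
    exact le_bot_iff.1 (hc ▸ normal_le_normalCore.2 inf_le_right)
  refine ⟨inferInstance, hX, hd, hV, hs, hc, le_antisymm (fun x hx => ?_) (zpowers_le.2 hg), hn⟩
  obtain ⟨v, hv, z, hz, rfl⟩ := mem_sup_of_normal_left.1 (htop ▸ mem_top x)
  have : v ∈ commutator Q ⊓ X := ⟨hv, (X.mul_mem_cancel_right (zpowers_le.2 hg hz)).1 hx⟩
  rw [hd, mem_bot] at this
  simpa [this] using hz

/-! ### Maximal subgroups of a soluble group with private elements -/

section Solvable

variable {G : Type*} [Group G]

/-- Otherwise a maximal subgroup above `G'`, necessarily normal, contains the private element of `X`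
and so equals `X`. -/
theorem exists_commutator_sup_zpowers_eq_top [Finite G] (hp : HasPrivateElements G) {X : Subgroup G}
    (hX : IsCoatom X) (hn : ¬ X.Normal) :
    ∃ g ∈ X, commutator G ⊔ zpowers g = ⊤ := by
  obtain ⟨g, hg, hu⟩ := hp X hX
  refine ⟨g, hg, ?_⟩
  by_contra h
  obtain ⟨Y, hY, hle⟩ := (eq_top_or_exists_le_coatom _).resolve_left h
  obtain rfl := hu Y hY (hle (le_sup_right (a := commutator G) (mem_zpowers g)))
  exact hn (Subgroup.Normal.of_commutator_le _ (le_sup_left.trans hle))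

theorem commutator_commutator_le [Finite G] [Group.IsSolvable G] (hp : HasPrivateElements G)
    {X : Subgroup G} (hX : IsCoatom X) (hn : ¬ X.Normal) :
    ⁅commutator G, commutator G⁆ ≤ X := by
  obtain ⟨g, hg, hu⟩ := hp X hX
  have h : ⁅commutator G, commutator G⁆ ⊔ zpowers g ≠ ⊤ := by
    intro h
    -- `G` modulo `G''` would be cyclic, so `G' = G''`, which solubility allows only for `G' = 1`.
    have hle : commutator G ≤ ⁅commutator G, commutator G⁆ :=
      Normal.commutator_le_of_self_sup_commutative_eq_top h inferInstance
    by_cases hb : commutator G = ⊥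
    · exact hn (Subgroup.Normal.of_commutator_le _ (hb.le.trans bot_le))
    · exact (Group.IsSolvable.commutator_lt_of_ne_bot hb).not_ge hle
  obtain ⟨Y, hY, hle⟩ := (eq_top_or_exists_le_coatom _).resolve_left h
  obtain rfl := hu Y hY (hle (mem_sup_right (mem_zpowers g)))
  exact le_sup_left.trans hle

/-- An arbitrary surjection lets this serve both `G / core X` and, once the two kernels are known to
agree, `G / Φ(G)`. -/
theorem isCyclicPrimitive_of_surjective [Finite G] [Group.IsSolvable G] {Q : Type*} [Group Q]
    (hp : HasPrivateElements G) {X : Subgroup G} (hX : IsCoatom X) (hn : ¬ X.Normal)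
    {π : G →* Q} (hsurj : Function.Surjective π) (hker : π.ker = X.normalCore) :
    ∃ g, IsCyclicPrimitive (commutator Q) (X.map π) g := by
  have hcm : (X.map π).comap π = X := by
    rw [comap_map_eq, hker, sup_eq_left]
    exact normalCore_le X
  have hmapc : commutator Q = (commutator G).map π := by
    rw [commutator_def, commutator_def, map_commutator, map_top_of_surjective _ hsurj]
  have hcc := commutator_commutator_le hp hX hn
  obtain ⟨g, hg, htop⟩ := exists_commutator_sup_zpowers_eq_top hp hX hn
  refine ⟨π g, isCyclicPrimitive_commutator ⟨?_, fun K hK => ?_⟩ ?_ ?_ ?_ (mem_map_of_mem _ hg) ?_⟩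
  · intro h
    rw [h, comap_top] at hcm
    exact hX.1 hcm.symm
  · have hlt : X < K.comap π := by
      have := (comap_lt_comap_of_surjective hsurj).2 hK
      rwa [hcm] at this
    rw [← map_comap_eq_self_of_surjective hsurj K, hX.2 _ hlt, map_top_of_surjective _ hsurj]
  · have h1 : ((X.map π).normalCore).comap π ≤ X.normalCore :=
      normal_le_normalCore.2 ((comap_mono (normalCore_le _)).trans hcm.le)
    rw [← map_comap_eq_self_of_surjective hsurj (X.map π).normalCore, Subgroup.map_eq_bot_iff, hker]
    exact h1
  · intro h
    have := h.comap π
    rw [hcm] at this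
    exact hn this
  · rw [hmapc, ← map_commutator, Subgroup.map_eq_bot_iff, hker]
    exact normal_le_normalCore.2 hcc
  · rw [hmapc, ← MonoidHom.map_zpowers, ← Subgroup.map_sup, htop, map_top_of_surjective _ hsurj]

theorem isCyclicPrimitive_quotient_normalCore [Finite G] [Group.IsSolvable G] (hp : HasPrivateElements G)
    {X : Subgroup G} (hX : IsCoatom X) (hn : ¬ X.Normal) :
    ∃ g, IsCyclicPrimitive (commutator (G ⧸ X.normalCore))
      (X.map (QuotientGroup.mk' X.normalCore)) g :=
  isCyclicPrimitive_of_surjective hp hX hn (QuotientGroup.mk'_surjective _)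
    (QuotientGroup.ker_mk' _)

/-- The normal subgroup `G' · core X`, as a preimage. -/
abbrev commutatorCore (X : Subgroup G) : Subgroup G :=
  (commutator (G ⧸ X.normalCore)).comap (QuotientGroup.mk' X.normalCore)

theorem commutator_le_commutatorCore (X : Subgroup G) : commutator G ≤ commutatorCore X := by
  rw [commutatorCore, ← map_le_iff_le_comap, commutator_def, commutator_def, map_commutator]
  exact commutator_mono le_top le_top

theorem commutatorCore_ne_top [Finite G] [Group.IsSolvable G] (hp : HasPrivateElements G)
    {X : Subgroup G} (hX : IsCoatom X) (hn : ¬ X.Normal) : commutatorCore X ≠ ⊤ := by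
  obtain ⟨g, h⟩ := isCyclicPrimitive_quotient_normalCore hp hX hn
  intro ht
  have hV : commutator (G ⧸ X.normalCore) = ⊤ := by
    rw [← map_comap_eq_self_of_surjective (QuotientGroup.mk'_surjective X.normalCore)
      (commutator (G ⧸ X.normalCore)), show comap _ _ = ⊤ from ht,
      map_top_of_surjective _ (QuotientGroup.mk'_surjective X.normalCore)]
  have hb := h.inf_eq_bot
  rw [hV, top_inf_eq] at hb
  exact h.not_normal (hb ▸ inferInstance)

theorem exists_conj_mem_of_notMem_commutatorCore [Finite G] [Group.IsSolvable G]
    (hp : HasPrivateElements G) {X : Subgroup G} (hX : IsCoatom X) (hn : ¬ X.Normal) {y : G}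
    (hy : y ∉ commutatorCore X) : ∃ t, t * y * t⁻¹ ∈ X := by
  obtain ⟨g, h⟩ := isCyclicPrimitive_quotient_normalCore hp hX hn
  obtain ⟨t, ht⟩ := exists_conj_mem_of_notMem h.isCoatom h.inf_eq_bot h.comm h.comm_right h.sup_eq_top
    h.normalCore_eq_bot (y := QuotientGroup.mk' X.normalCore y) hy
  obtain ⟨t, rfl⟩ := QuotientGroup.mk'_surjective X.normalCore t
  refine ⟨t, ?_⟩
  obtain ⟨x, hx, hxt⟩ := ht
  have h1 : x⁻¹ * (t * y * t⁻¹) ∈ X.normalCore := by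
    rw [← QuotientGroup.eq]
    exact hxt
  exact (X.mul_mem_cancel_left (X.inv_mem hx)).1 (normalCore_le X h1)

theorem isCoatom_conj {X : Subgroup G} (hX : IsCoatom X) (t : G) :
    IsCoatom (X.map (MulAut.conj t).toMonoidHom) :=
  (OrderIso.isCoatom_iff (MulAut.conj t).mapSubgroup X).2 hX

theorem mem_conj_of_conj_mem {X : Subgroup G} {t y : G} (h : t * y * t⁻¹ ∈ X) :
    y ∈ X.map (MulAut.conj t⁻¹).toMonoidHom :=
  ⟨_, h, by simp [mul_assoc]⟩

theorem not_normal_conj {X : Subgroup G} (hn : ¬ X.Normal) (t : G) :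
    ¬ (X.map (MulAut.conj t).toMonoidHom).Normal := by
  intro h
  have hc : (X.map (MulAut.conj t).toMonoidHom).comap (MulAut.conj t).toMonoidHom = X :=
    comap_map_eq_self_of_injective (MulAut.conj t).injective X
  exact hn (hc ▸ h.comap _)

/-- There is a single normal maximal subgroup, and the other ones are conjugate. -/
theorem exists_isCoatom_iff [Finite G] [Group.IsSolvable G] (hp : HasPrivateElements G) {X : Subgroup G}
    (hX : IsCoatom X) (hn : ¬ X.Normal) :
    ∃ M : Subgroup G, M.Normal ∧ IsCoatom M ∧ commutatorCore X ≤ M ∧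
      ∀ Y : Subgroup G, IsCoatom Y ↔ Y = M ∨ ∃ t, Y = X.map (MulAut.conj t).toMonoidHom := by
  obtain ⟨M, hM, hle⟩ :=
    (eq_top_or_exists_le_coatom _).resolve_left (commutatorCore_ne_top hp hX hn)
  have hMn : M.Normal := Subgroup.Normal.of_commutator_le _ ((commutator_le_commutatorCore X).trans hle)
  refine ⟨M, hMn, hM, hle, fun Y => ⟨fun hY => ?_, ?_⟩⟩
  -- A private element of `Y` lies either in `M` or in a conjugate of `X`, which must then be `Y`.
  · obtain ⟨y, hy, hu⟩ := hp Y hY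
    by_cases hyc : y ∈ commutatorCore X
    · exact Or.inl (hu M hM (hle hyc)).symm
    · obtain ⟨t, ht⟩ := exists_conj_mem_of_notMem_commutatorCore hp hX hn hyc
      exact Or.inr ⟨t⁻¹, (hu _ (isCoatom_conj hX _) (mem_conj_of_conj_mem ht)).symm⟩
  · rintro (rfl | ⟨t, rfl⟩)
    · exact hM
    · exact isCoatom_conj hX t

theorem frattini_eq_normalCore [Finite G] [Group.IsSolvable G] (hp : HasPrivateElements G) {X : Subgroup G}
    (hX : IsCoatom X) (hn : ¬ X.Normal) : frattini G = X.normalCore := by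
  obtain ⟨M, hMn, hM, hle, hiff⟩ := exists_isCoatom_iff hp hX hn
  refine le_antisymm (normal_le_normalCore.2 (frattini_le_coatom hX)) ?_
  refine le_iInf₂ fun Y hY => ?_
  rcases (hiff Y).1 hY with rfl | ⟨t, rfl⟩
  · refine le_trans ?_ hle
    rw [commutatorCore]
    conv_lhs => rw [← QuotientGroup.ker_mk' X.normalCore]
    exact ker_le_comap _ _
  · intro x hx
    exact ⟨t⁻¹ * x * t, by simpa using (normalCore_le X) (Normal.conj_mem inferInstance x hx t⁻¹),
      by simp [mul_assoc]⟩

/-! ### Counting the conjugates of a self-normalizing maximal subgroup -/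

theorem mem_of_map_conj_eq {X : Subgroup G} (hX : IsCoatom X) (hn : ¬ X.Normal) {t : G}
    (h : X.map (MulAut.conj t).toMonoidHom = X) : t ∈ X := by
  have ht : t ∈ normalizer (X : Set G) := by
    refine mem_normalizer_iff.2 fun x => ⟨fun hx => h ▸ ⟨x, hx, rfl⟩, fun hx => ?_⟩
    have hx' : t * x * t⁻¹ ∈ X := hx
    rw [← h] at hx'
    obtain ⟨x', hx', he⟩ := hx'
    rwa [← (MulAut.conj t).injective he]
  rcases (hX.le_iff).1 (le_normalizer (H := X)) with h' | h'
  · exact absurd (normalizer_eq_top_iff.1 h') hn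
  · rwa [h'] at ht

theorem map_conj_mul (X : Subgroup G) (s t : G) :
    X.map (MulAut.conj (s * t)).toMonoidHom =
      (X.map (MulAut.conj t).toMonoidHom).map (MulAut.conj s).toMonoidHom := by
  rw [map_map]
  congr 1
  ext x
  simp [mul_assoc]

theorem map_conj_one (X : Subgroup G) : X.map (MulAut.conj (1 : G)).toMonoidHom = X := by
  ext x
  simp

theorem map_conj_eq_of_mem {X : Subgroup G} {t : G} (h : t ∈ X) :
    X.map (MulAut.conj t).toMonoidHom = X := by
  ext x
  constructor
  · rintro ⟨y, hy, rfl⟩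
    exact X.mul_mem (X.mul_mem h hy) (X.inv_mem h)
  · intro hx
    exact ⟨t⁻¹ * x * t, X.mul_mem (X.mul_mem (X.inv_mem h) hx) h, by simp [mul_assoc]⟩

theorem card_range_map_conj {X : Subgroup G} (hX : IsCoatom X) (hn : ¬ X.Normal) :
    (Set.range fun t : G => X.map (MulAut.conj t).toMonoidHom).ncard = X.index := by
  have hinj : Function.Injective
      fun q : G ⧸ X => X.map (MulAut.conj (Quotient.out q)).toMonoidHom := by
    intro q r hqr
    rw [← QuotientGroup.out_eq' q, ← QuotientGroup.out_eq' r, QuotientGroup.eq]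
    refine mem_of_map_conj_eq hX hn ?_
    rw [map_conj_mul, ← show X.map _ = X.map _ from hqr, ← map_conj_mul, inv_mul_cancel,
      map_conj_one]
  have hrange : (Set.range fun t : G => X.map (MulAut.conj t).toMonoidHom) =
      Set.range fun q : G ⧸ X => X.map (MulAut.conj (Quotient.out q)).toMonoidHom := by
    refine Set.Subset.antisymm ?_ ?_
    · rintro _ ⟨t, rfl⟩
      obtain ⟨x, hx⟩ := QuotientGroup.mk_out_eq_mul X t
      refine ⟨(t : G ⧸ X), ?_⟩
      dsimp only
      rw [hx, map_conj_mul, map_conj_eq_of_mem x.2]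
    · rintro _ ⟨q, rfl⟩
      exact ⟨_, rfl⟩
  rw [hrange, Set.ncard_range_of_injective hinj]
  rfl

theorem numMaximalSubgroups_eq [Finite G] [Group.IsSolvable G] (hp : HasPrivateElements G)
    {X : Subgroup G} (hX : IsCoatom X) (hn : ¬ X.Normal) :
    numMaximalSubgroups G = X.index + 1 := by
  obtain ⟨M, hMn, hM, hle, hiff⟩ := exists_isCoatom_iff hp hX hn
  have hset : {Y : Subgroup G | IsCoatom Y} =
      insert M (Set.range fun t : G => X.map (MulAut.conj t).toMonoidHom) := by
    ext Y
    simp only [Set.mem_ofPred_eq, hiff, Set.mem_insert_iff, Set.mem_range, eq_comm]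
  have hnot : M ∉ Set.range fun t : G => X.map (MulAut.conj t).toMonoidHom := by
    rintro ⟨t, rfl⟩
    exact not_normal_conj hn t hMn
  rw [← card_range_map_conj hX hn, ← Set.ncard_insert_of_notMem hnot (Set.toFinite _), ← hset]
  rfl

end Solvable

/-! ### Structure of the primitive quotient -/

namespace IsCyclicPrimitive

variable {Q : Type*} [Group Q] {V X : Subgroup Q} {g : Q} (h : IsCyclicPrimitive V X g)

include h

theorem isComplement' [Finite Q] : V.IsComplement' X := by
  have := h.normal
  refine isComplement'_of_disjoint_and_mul_eq_univ (disjoint_iff.2 h.inf_eq_bot) ?_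
  rw [← normal_mul, h.sup_eq_top, coe_top]

theorem isElementaryAbelian [Finite Q] : IsElementaryAbelian V := by
  have := h.normal
  refine ⟨fun x y => Subtype.ext (h.comm x x.2 y y.2), ?_⟩
  have hne : Nat.card V ≠ 1 := by
    intro h1
    have hs := h.sup_eq_top
    rw [card_eq_one.1 h1, bot_sup_eq] at hs
    exact h.isCoatom.1 hs
  obtain ⟨r, hr, hdvd⟩ := Nat.exists_prime_and_dvd hne
  refine ⟨r, hr, ?_⟩
  have := Fact.mk hr
  -- `T` is normal in `Q`, and nontrivial by Cauchy, so minimality of `V` gives `T = V`.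
  let T : Subgroup Q :=
    { carrier := {v | v ∈ V ∧ v ^ r = 1}
      one_mem' := ⟨V.one_mem, one_pow r⟩
      mul_mem' := fun {a b} ha hb => ⟨V.mul_mem ha.1 hb.1, by
        rw [Commute.mul_pow (h.comm a ha.1 b hb.1), ha.2, hb.2, one_mul]⟩
      inv_mem' := fun {a} ha => ⟨V.inv_mem ha.1, by rw [inv_pow, ha.2, inv_one]⟩ }
  have hTn : T.Normal :=
    ⟨fun n hn b => ⟨h.normal.conj_mem n hn.1 b, by rw [conj_pow, hn.2, mul_one, mul_inv_cancel]⟩⟩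
  have hTV : T ≤ V := fun v hv => hv.1
  obtain ⟨v, hv⟩ := exists_prime_orderOf_dvd_card' r hdvd
  rcases eq_bot_or_eq_of_normal_le h.isCoatom h.inf_eq_bot hTV with hT | hT
  · have hvT : (v : Q) ∈ T := ⟨v.2, by rw [← coe_pow, ← hv, pow_orderOf_eq_one, coe_one]⟩
    rw [hT, mem_bot] at hvT
    have : v = 1 := Subtype.ext hvT
    rw [this, orderOf_one] at hv
    exact absurd hv.symm hr.one_lt.ne'
  · intro x
    have hx : (x : Q) ∈ T := hT.symm.le x.2
    exact Subtype.ext hx.2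

theorem nat_card_eq_index [Finite Q] : Nat.card V = X.index :=
  h.isComplement'.index_eq_card.symm

theorem ne_one : g ≠ 1 := by
  rintro rfl
  refine h.not_normal ?_
  rw [h.zpowers_eq, zpowers_one_eq_bot]
  infer_instance

theorem card_right : Nat.card X = orderOf g := by
  rw [h.zpowers_eq, Nat.card_zpowers]

/-- If a single proper subgroup above `V` contains all proper subgroups above `V`, then the order
of `g` is a power of a prime. -/
theorem exists_orderOf_eq_prime_pow [Finite Q]
    (hM : ∃ M : Subgroup Q, M ≠ ⊤ ∧ ∀ K : Subgroup Q, V ≤ K → K ≠ ⊤ → K ≤ M) :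
    ∃ p α : ℕ, p.Prime ∧ 0 < α ∧ orderOf g = p ^ α := by
  obtain ⟨M, hM, hle⟩ := hM
  have := h.normal
  have hV : V ≠ ⊤ := by
    intro hV
    have := h.inf_eq_bot
    rw [hV, top_inf_eq, h.zpowers_eq, zpowers_eq_bot] at this
    exact h.ne_one this
  have hgM : g ∉ M := by
    intro hg
    refine hM (top_le_iff.1 (h.sup_eq_top ▸ sup_le (hle V le_rfl hV) ?_))
    rw [h.zpowers_eq]
    exact zpowers_le.2 hg
  -- `V⟨g ^ q⟩` is proper because `g` is not a power of `g ^ q`. Two distinct such primes would put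
  -- `g` in `M` by Bézout.
  have hpow : ∀ q : ℕ, q.Prime → q ∣ orderOf g → g ^ q ∈ M := by
    intro q hq hdvd
    refine hle (V ⊔ zpowers (g ^ q)) le_sup_left (fun ht => ?_)
      (mem_sup_right (mem_zpowers _))
    obtain ⟨v, hv, z, hz, hvz⟩ := mem_sup_of_normal_left.1 (ht ▸ mem_top g)
    obtain ⟨k, rfl⟩ := mem_zpowers_iff.1 hz
    have hgX : g ∈ X := h.zpowers_eq ▸ mem_zpowers g
    have hzX : (g ^ q) ^ k ∈ X := X.zpow_mem (X.pow_mem hgX q) k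
    have hv1 : v ∈ V ⊓ X := ⟨hv, (X.mul_mem_cancel_right hzX).1 (by rwa [hvz])⟩
    rw [h.inf_eq_bot, mem_bot] at hv1
    rw [hv1, one_mul] at hvz
    have h1 : g ^ ((q : ℤ) * k - 1) = 1 := by
      rw [zpow_sub_one, zpow_mul, zpow_natCast]
      exact mul_inv_eq_one.2 hvz
    have h2 : (q : ℤ) ∣ q * k - 1 :=
      (Int.natCast_dvd_natCast.2 hdvd).trans (orderOf_dvd_iff_zpow_eq_one.2 h1)
    have h3 : (q : ℤ) ∣ 1 := by simpa using (Dvd.intro k rfl : (q : ℤ) ∣ q * k).sub h2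
    exact hq.one_lt.ne' (by exact_mod_cast Int.eq_one_of_dvd_one (by positivity) h3)
  have hone : orderOf g ≠ 1 := fun h1 => h.ne_one (orderOf_eq_one_iff.1 h1)
  obtain ⟨p, hp, hpd⟩ := Nat.exists_prime_and_dvd hone
  have hfact : orderOf g = p ^ (orderOf g).primeFactorsList.length := by
    refine Nat.eq_prime_pow_of_unique_prime_dvd (orderOf_pos g).ne' fun {q} hq hqd => ?_
    by_contra hne
    have hcop : IsCoprime (q : ℤ) (p : ℤ) :=
      Nat.isCoprime_iff_coprime.2 ((Nat.coprime_primes hq hp).2 hne)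
    obtain ⟨a, b, hab⟩ := hcop
    refine hgM ?_
    have : g = (g ^ q) ^ a * (g ^ p) ^ b := by
      rw [← zpow_natCast, ← zpow_natCast, ← zpow_mul, ← zpow_mul, ← zpow_add, mul_comm (q : ℤ),
        mul_comm (p : ℤ), hab, zpow_one]
    rw [this]
    exact M.mul_mem (M.zpow_mem (hpow q hq hqd) a) (M.zpow_mem (hpow p hp hpd) b)
  refine ⟨p, _, hp, Nat.pos_of_ne_zero fun h0 => hone ?_, hfact⟩
  rw [hfact, h0, pow_zero]

theorem exists_semidirectProduct [Finite Q] {n : ℕ} (hn : orderOf g = n) :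
    ∃ φ : Multiplicative (ZMod n) →* MulAut V, Function.Injective φ ∧
      Nonempty (Q ≃* V ⋊[φ] Multiplicative (ZMod n)) := by
  have := h.normal
  have hXc : IsCyclic X := (Subgroup.isCyclic_iff_exists_zpowers_eq_top X).2 ⟨g, h.zpowers_eq.symm⟩
  let e : X ≃* Multiplicative (ZMod n) :=
    ((h.card_right.trans hn) ▸ zmodCyclicMulEquiv hXc).symm
  let ψ : X →* MulAut V :=
    V.normalizerMonoidHom.comp (inclusion (V.normalizer_eq_top ▸ le_top))
  have hψ : Function.Injective ψ := by
    rw [injective_iff_map_eq_one]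
    intro x hx
    refine Subtype.ext (eq_one_of_mem_of_commute h.comm_right h.sup_eq_top h.normalCore_eq_bot x.2
      fun v hv => ?_)
    have : ((ψ x ⟨v, hv⟩ : V) : Q) = v := by rw [hx]; rfl
    exact mul_inv_eq_iff_eq_mul.1 this
  refine ⟨(MulAut.congr (MulEquiv.refl V)).toMonoidHom.comp (ψ.comp e.symm.toMonoidHom), ?_,
    ⟨(SemidirectProduct.mulEquivSubgroup h.isComplement').symm.trans
      (SemidirectProduct.congr' (MulEquiv.refl V) e)⟩⟩
  exact (MulAut.congr (MulEquiv.refl V)).injective.comp (hψ.comp e.symm.injective)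

end IsCyclicPrimitive

/-- A group of order 2 has no nontrivial automorphism. This is what rules out σ(G) = 3. -/
theorem card_ne_two_of_injective {E : Type*} [Group E] [Finite E] {n : ℕ} (hn : 1 < n)
    {φ : Multiplicative (ZMod n) →* MulAut E} (hφ : Function.Injective φ) : Nat.card E ≠ 2 := by
  intro h2
  have := Fact.mk hn
  obtain ⟨a, b, hab⟩ := exists_pair_ne (Multiplicative (ZMod n))
  refine hab (hφ (MulEquiv.ext fun x => ?_))
  by_cases hx : x = 1
  · simp [hx]
  · obtain ⟨u, v, huv, huniv⟩ := Nat.card_eq_two_iff.1 h2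
    have key : ∀ y z : E, y ≠ 1 → z ≠ 1 → y = z := by
      have hm : ∀ y : E, y = u ∨ y = v := fun y => by
        have : y ∈ ({u, v} : Set E) := huniv ▸ Set.mem_univ y
        simpa using this
      intro y z hy hz
      rcases hm 1 with h1 | h1 <;> rcases hm y with h3 | h3 <;> rcases hm z with h4 | h4 <;>
        simp_all
    exact key _ _ (by simpa using hx) (by simpa using hx)

theorem lemma3p2 (G : Type u) [Group G] [Finite G] [Group.IsSolvable G]
    (hnil : ¬ Group.IsNilpotent G)
    (hσ : coveringNumber G = numMaximalSubgroups G) :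
    coveringNumber G ≠ 3 ∧
      ∃ (E : Type u) (_ : Group E) (p α : ℕ)
        (φ : Multiplicative (ZMod (p ^ α)) →* MulAut E),
        IsElementaryAbelian E ∧ Nat.card E + 1 = coveringNumber G ∧
        p.Prime ∧ 0 < α ∧ Function.Injective φ ∧
        Nonempty (G ⧸ frattini G ≃* E ⋊[φ] Multiplicative (ZMod (p ^ α))) := by
  have hcyc : ¬ IsCyclic G := by
    intro hc
    refine hnil ((Group.isNilpotent_of_finite_tfae.out 2 0).1 fun H _ =>
      Subgroup.Normal.mk fun n hn b => ?_)
    rwa [IsMulCommutative.is_comm.comm b n, mul_inv_cancel_right]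
  have hp := hasPrivateElements_of_coveringNumber_eq hcyc hσ
  obtain ⟨X, hX, hn⟩ : ∃ X : Subgroup G, IsCoatom X ∧ ¬ X.Normal := by
    by_contra! hall
    exact hnil ((Group.isNilpotent_of_finite_tfae.out 2 0).1 hall)
  have hsurj := QuotientGroup.mk'_surjective (frattini G)
  have hker : (QuotientGroup.mk' (frattini G)).ker = X.normalCore :=
    (QuotientGroup.ker_mk' _).trans (frattini_eq_normalCore hp hX hn)
  obtain ⟨g, h⟩ := isCyclicPrimitive_of_surjective hp hX hn hsurj hker
  obtain ⟨M, -, hM, -, hiff⟩ := exists_isCoatom_iff hp hX hn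
  have hcard : Nat.card (commutator (G ⧸ frattini G)) + 1 = coveringNumber G := by
    rw [hσ, numMaximalSubgroups_eq hp hX hn, h.nat_card_eq_index,
      index_map_eq _ hsurj (hker.le.trans (normalCore_le X))]
  obtain ⟨p, α, hpp, hα, hord⟩ := h.exists_orderOf_eq_prime_pow (by
    refine ⟨M.map (QuotientGroup.mk' (frattini G)), fun hMt => hM.1 ?_, fun K hVK hK => ?_⟩
    · have hcm := comap_map_eq (QuotientGroup.mk' (frattini G)) M
      rw [hMt, comap_top, QuotientGroup.ker_mk', sup_eq_left.2 (frattini_le_coatom hM)] at hcm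
      exact hcm.symm
    · rw [← map_comap_eq_self_of_surjective hsurj K]
      refine map_mono ?_
      have hne : K.comap (QuotientGroup.mk' (frattini G)) ≠ ⊤ := fun ht => hK (by
        rw [← map_comap_eq_self_of_surjective hsurj K, ht, map_top_of_surjective _ hsurj])
      obtain ⟨Y, hY, hKY⟩ := (eq_top_or_exists_le_coatom _).resolve_left hne
      -- `Y` contains `G'` because `K` contains the derived subgroup of the quotient; the only
      -- normal maximal subgroup is `M`.
      have hYn : Y.Normal := by
        refine Subgroup.Normal.of_commutator_le _ (le_trans ?_ hKY)
        rw [← map_le_iff_le_comap]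
        refine le_trans ?_ hVK
        rw [commutator_def, commutator_def, map_commutator]
        exact commutator_mono le_top le_top
      rcases (hiff Y).1 hY with rfl | ⟨t, rfl⟩
      · exact hKY
      · exact absurd hYn (not_normal_conj hn t))
  obtain ⟨φ, hφ, he⟩ := h.exists_semidirectProduct hord
  refine ⟨fun h3 => ?_, commutator (G ⧸ frattini G), inferInstance, p, α, φ,
    h.isElementaryAbelian, hcard, hpp, hα, hφ, he⟩
  exact card_ne_two_of_injective (Nat.one_lt_pow hα.ne' hpp.one_lt) hφ (by omega)
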